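/- **Lemma (orbit space diffeomorphic to $T^*L(p,q)$).** Let $p,q$ be coprime integers with $1\le q<p$ and let $\mu>0$ be real. Let $X_\mu=\{(x,y,z,t)\in\mathbb{C}^4 : xy-zt=\mu\}$ be the deformed conifold, regarded as a smooth ($6$-dimensional real) submanifold of $\mathbb{C}^4$, and let $\mathbb{Z}_p$, realized as the group of complex $p$-th roots of unity, act freely on $X_\mu$ by $$\omega\cdot(x,y,z,t)=(\omega x,\ \omega^{-1}y,\ \omega^{q}z,\ \omega^{-q}t).$$ Let $L(p,q)$ be the lens space, that is, the quotient of the unit sphere $S^3=\{(x,z)\in\mathbb{C}^2 : |x|^2+|z|^2=1\}$ by the free action $\omega\cdot(x,z)=(\omega x,\omega^{q}z)$ of $\mathbb{Z}_p$. Both orbit spaces carry the quotient smooth structure. Then the orbit space $X_\mu/\mathbb{Z}_p$ is $C^\infty$-diffeomorphic to the total space of the cotangent bundle $T^*L(p,q)$. -/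

import Mathlib

open scoped Manifold ContDiff

noncomputable section

/-! ## Quotients of smooth manifolds by free actions of finite groups

The charts on the orbit space are those of `MulAction.instChartedSpaceQuotient`: local inverses of
the quotient map followed by charts of the manifold upstairs. -/

section Quotient

variable {E H M G : Type*} [NormedAddCommGroup E] [NormedSpace ℝ E] [TopologicalSpace H]
  [TopologicalSpace M] [ChartedSpace H M] [Group G] [MulAction G M]
  [ProperlyDiscontinuousSMul G M] [ContinuousConstSMul G M] [IsCancelSMul G M]
  [T2Space M] [LocallyCompactSpace M]

/-- The orbit space of a smooth free properly discontinuous action is a smooth manifold. -/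
theorem isManifold_orbitSpace (I : ModelWithCorners ℝ E H) [IsManifold I ∞ M]
    (hG : ∀ g : G, ContMDiff I I ∞ (fun x : M => g • x)) :
    IsManifold I ∞ (MulAction.orbitRel.Quotient G M) := by
  have hcov := isQuotientCoveringMap_quotientMk_of_properlyDiscontinuousSMul (G := G) (E := M)
  have hloc : IsLocalHomeomorph (Quotient.mk (MulAction.orbitRel G M)) :=
    hcov.isCoveringMap.isLocalHomeomorph
  have key : ∀ a b : M, ContDiffOn ℝ ∞
      (I ∘ ((hloc.localInverseAt a).trans (chartAt H a)).symm ≫ₕ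
        ((hloc.localInverseAt b).trans (chartAt H b)) ∘ I.symm)
      (I.symm ⁻¹' (((hloc.localInverseAt a).trans (chartAt H a)).symm ≫ₕ
        ((hloc.localInverseAt b).trans (chartAt H b))).source ∩ Set.range I) := by
    intro a b u hu
    obtain ⟨hu1, hu2⟩ := hu
    simp only [OpenPartialHomeomorph.trans_symm_eq_symm_trans_symm, Set.mem_preimage,
      OpenPartialHomeomorph.trans_source, OpenPartialHomeomorph.symm_source, Set.mem_inter_iff,
      OpenPartialHomeomorph.coe_trans, Function.comp_apply, IsLocalHomeomorph.localInverseAt_symm] at hu1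
    obtain ⟨⟨h1, h2⟩, h3, h4⟩ := hu1
    set m := (chartAt H a).symm (I.symm u) with hm
    have hπ : Quotient.mk (MulAction.orbitRel G M)
        (hloc.localInverseAt b (Quotient.mk (MulAction.orbitRel G M) m)) =
        Quotient.mk (MulAction.orbitRel G M) m := hloc.apply_localInverseAt_of_mem h3
    obtain ⟨g, hg⟩ := hcov.apply_eq_iff_mem_orbit.1 hπ
    have hg' : g • m = hloc.localInverseAt b (Quotient.mk (MulAction.orbitRel G M) m) := hg
    -- near `m`, the local inverse at `b` after projection is the action of `g`
    have hev : ∀ᶠ x in nhds m,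
        hloc.localInverseAt b (Quotient.mk (MulAction.orbitRel G M) x) = g • x := by
      have e1 : ∀ᶠ x in nhds m, Quotient.mk (MulAction.orbitRel G M) x ∈
          (hloc.localInverseAt b).source :=
        hloc.continuous.continuousAt.eventually ((hloc.localInverseAt b).open_source.mem_nhds h3)
      have e2 : ∀ᶠ x in nhds m, g • x ∈ (hloc.localInverseAt b).target := by
        refine (continuous_const_smul g).continuousAt.eventually
          ((hloc.localInverseAt b).open_target.mem_nhds ?_)
        change g • m ∈ _
        rw [hg']
        exact (hloc.localInverseAt b).map_source h3
      filter_upwards [e1, e2] with x hx1 hx2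
      refine hloc.injOn_localInverseAt_target ((hloc.localInverseAt b).map_source hx1) hx2 ?_
      rw [hloc.apply_localInverseAt_of_mem hx1]
      exact (hcov.map_smul g).symm
    have hu_t : u ∈ (extChartAt I a).target := by
      rw [extChartAt_target]; exact ⟨h1, hu2⟩
    have hsymm : ContMDiffWithinAt 𝓘(ℝ, E) I ∞ (extChartAt I a).symm (extChartAt I a).target u :=
      contMDiffOn_extChartAt_symm a u hu_t
    have hmid : ContMDiffAt I 𝓘(ℝ, E) ∞ (fun x : M => extChartAt I b (g • x)) m := by
      have hb : ContMDiffAt I 𝓘(ℝ, E) ∞ (extChartAt I b) (g • m) := by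
        refine contMDiffAt_extChartAt' ?_
        rw [hg']; exact h4
      exact hb.comp m (hG g m)
    have hcomp : ContDiffWithinAt ℝ ∞
        ((fun x : M => extChartAt I b (g • x)) ∘ (extChartAt I a).symm)
        (extChartAt I a).target u :=
      (ContMDiffAt.comp_contMDiffWithinAt u (by simpa [hm] using hmid) hsymm).contDiffWithinAt
    refine ((hcomp.mono_of_mem_nhdsWithin ?_).congr_of_eventuallyEq ?_ ?_)
    · rw [extChartAt_target]
      refine Filter.inter_mem ?_ (Filter.mem_of_superset self_mem_nhdsWithin fun x hx => hx.2)
      exact Filter.mem_of_superset self_mem_nhdsWithin fun x hx => hx.1.1.1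
    · have hc : ContinuousWithinAt (fun v => (chartAt H a).symm (I.symm v)) Set.univ u := by
        refine ContinuousAt.continuousWithinAt ?_
        exact ((chartAt H a).continuousAt_symm h1).comp I.continuous_symm.continuousAt
      have := (continuousWithinAt_univ _ _ |>.1 hc).eventually hev
      filter_upwards [mem_nhdsWithin_of_mem_nhds this] with v hv
      simp [OpenPartialHomeomorph.trans_symm_eq_symm_trans_symm, hv]
    · have := hev.self_of_nhds
      simp [OpenPartialHomeomorph.trans_symm_eq_symm_trans_symm, ← hm, this]
  apply isManifold_of_contDiffOn
  rintro _ _ ⟨q, rfl⟩ ⟨q', rfl⟩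
  exact key _ _
end Quotient

/-! ## The cyclic group -/

/-- Coprime integers `1 ≤ q < p`. -/
class LensPair (p q : ℕ) : Prop where
  one_le : 1 ≤ q
  lt : q < p
  coprime : Nat.Coprime p q

/-- The cyclic group `ℤ_p`, realized as the group of complex `p`-th roots of unity. The parameter
`q` does not affect the group: it only records the weight of the actions below. -/
def CyclicGp (p _q : ℕ) : Type := rootsOfUnity p ℂ

instance (p q : ℕ) : CommGroup (CyclicGp p q) := inferInstanceAs (CommGroup (rootsOfUnity p ℂ))

instance (p q : ℕ) [h : LensPair p q] : Finite (CyclicGp p q) :=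
  haveI : NeZero p := ⟨by have := h.lt; omega⟩
  inferInstanceAs (Finite (rootsOfUnity p ℂ))

namespace CyclicGp

variable {p q : ℕ}

/-- The complex number underlying a root of unity. -/
def toComplex : CyclicGp p q →* ℂ := (Units.coeHom ℂ).comp (rootsOfUnity p ℂ).subtype

theorem toComplex_ne_zero (g : CyclicGp p q) : toComplex g ≠ 0 :=
  Units.ne_zero (g : rootsOfUnity p ℂ).1

theorem toComplex_pow (g : CyclicGp p q) : toComplex g ^ p = 1 := by
  have h := (mem_rootsOfUnity' p (g : rootsOfUnity p ℂ).1).1 (g : rootsOfUnity p ℂ).2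
  exact h

theorem toComplex_injective : Function.Injective (toComplex : CyclicGp p q →* ℂ) :=
  fun _ _ h => Subtype.ext (Units.ext h)

theorem norm_toComplex [h : LensPair p q] (g : CyclicGp p q) : ‖toComplex g‖ = 1 :=
  Complex.norm_eq_one_of_pow_eq_one (toComplex_pow g) (by have := h.lt; omega)

theorem eq_of_pow_eq [h : LensPair p q] {g g' : CyclicGp p q}
    (hg : toComplex g ^ q = toComplex g' ^ q) : g = g' := by
  have h1 : (g / g') ^ q = 1 := toComplex_injective (by
    rw [div_pow, map_div, map_pow, map_pow, hg, map_one, div_self]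
    exact pow_ne_zero _ (toComplex_ne_zero g'))
  have h2 : (g / g') ^ p = 1 := toComplex_injective (by
    rw [map_pow, toComplex_pow, map_one])
  have h3 := pow_gcd_eq_one.2 ⟨h2, h1⟩
  rw [Nat.Coprime.gcd_eq_one h.coprime, pow_one] at h3
  exact div_eq_one.1 h3

end CyclicGp

/-! ## The deformed conifold -/

/-- The deformed conifold: the hypersurface `x y - z t = μ` in `ℂ⁴`. -/
@[ext]
structure Conifold (μ : ℝ) where
  x : ℂ
  y : ℂ
  z : ℂ
  t : ℂ
  eqn : x * y - z * t = μ

namespace Conifold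

variable {μ : ℝ}

/-- The inclusion into `ℂ⁴`. -/
def incl (v : Conifold μ) : ℂ × ℂ × ℂ × ℂ := (v.x, v.y, v.z, v.t)

/-- The subspace topology. -/
instance : TopologicalSpace (Conifold μ) := .induced incl inferInstance

theorem isInducing_incl : Topology.IsInducing (incl (μ := μ)) := ⟨rfl⟩

theorem isClosedEmbedding_incl : Topology.IsClosedEmbedding (incl (μ := μ)) := by
  refine ⟨⟨isInducing_incl, fun v w h => ?_⟩, ?_⟩
  · simpa [incl, Conifold.ext_iff] using h
  · have : Set.range (incl (μ := μ)) =
        {w | w.1 * w.2.1 - w.2.2.1 * w.2.2.2 = (μ : ℂ)} := by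
      ext w
      constructor
      · rintro ⟨v, rfl⟩
        exact v.eqn
      · intro hw
        exact ⟨⟨w.1, w.2.1, w.2.2.1, w.2.2.2, hw⟩, rfl⟩
    rw [this]
    exact isClosed_eq (by fun_prop) continuous_const

instance : T2Space (Conifold μ) := isClosedEmbedding_incl.isEmbedding.t2Space

instance : LocallyCompactSpace (Conifold μ) := isClosedEmbedding_incl.locallyCompactSpace

@[fun_prop]
theorem continuous_x : Continuous (Conifold.x (μ := μ)) :=
  continuous_fst.comp isInducing_incl.continuous

@[fun_prop]
theorem continuous_y : Continuous (Conifold.y (μ := μ)) :=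
  (continuous_fst.comp continuous_snd).comp isInducing_incl.continuous

@[fun_prop]
theorem continuous_z : Continuous (Conifold.z (μ := μ)) :=
  (continuous_fst.comp (continuous_snd.comp continuous_snd)).comp isInducing_incl.continuous

@[fun_prop]
theorem continuous_t : Continuous (Conifold.t (μ := μ)) :=
  (continuous_snd.comp (continuous_snd.comp continuous_snd)).comp isInducing_incl.continuous

/-- The chart `(x, y, z, t) ↦ (x, z, t)` on `x ≠ 0`, with inverse
`(x, z, t) ↦ (x, (μ + z t) / x, z, t)` (and a junk value where `x = 0`). -/
def chartX (μ : ℝ) : OpenPartialHomeomorph (Conifold μ) (ℂ × ℂ × ℂ) where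
  toFun v := (v.x, v.z, v.t)
  invFun w := if h : w.1 = 0 then ⟨1, μ, 0, 0, by simp⟩ else
    ⟨w.1, (μ + w.2.1 * w.2.2) / w.1, w.2.1, w.2.2, by rw [mul_div_cancel₀ _ h]; ring⟩
  source := {v | v.x ≠ 0}
  target := {w | w.1 ≠ 0}
  map_source' _ hv := hv
  map_target' w hw := by
    have hw' : w.1 ≠ 0 := hw
    simp [hw']
  left_inv' v hv := by
    have hv' : v.x ≠ 0 := hv
    have hy : (μ + v.z * v.t) / v.x = v.y := by
      rw [div_eq_iff hv']
      linear_combination -v.eqn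
    simp [hv', hy]
  right_inv' w hw := by
    have hw' : w.1 ≠ 0 := hw
    simp [hw']
  open_source := isOpen_ne_fun (by fun_prop) continuous_const
  open_target := isOpen_ne_fun (by fun_prop) continuous_const
  continuousOn_toFun := Continuous.continuousOn (by fun_prop)
  continuousOn_invFun := by
    rw [isInducing_incl.continuousOn_iff]
    have : ContinuousOn (fun w : ℂ × ℂ × ℂ =>
        ((w.1, (μ + w.2.1 * w.2.2) / w.1, w.2.1, w.2.2) : ℂ × ℂ × ℂ × ℂ)) {w | w.1 ≠ 0} := by
      fun_prop (disch := exact fun w hw => hw)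
    refine this.congr fun w hw => ?_
    have hw' : w.1 ≠ 0 := hw
    simp [incl, hw']

/-- The chart `(x, y, z, t) ↦ (x, y, z)` on `z ≠ 0`, with inverse
`(x, y, z) ↦ (x, y, z, (x y - μ) / z)` (and a junk value where `z = 0`). -/
def chartZ (μ : ℝ) : OpenPartialHomeomorph (Conifold μ) (ℂ × ℂ × ℂ) where
  toFun v := (v.x, v.y, v.z)
  invFun w := if h : w.2.2 = 0 then ⟨1, μ, 0, 0, by simp⟩ else
    ⟨w.1, w.2.1, w.2.2, (w.1 * w.2.1 - μ) / w.2.2, by rw [mul_div_cancel₀ _ h]; ring⟩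
  source := {v | v.z ≠ 0}
  target := {w | w.2.2 ≠ 0}
  map_source' _ hv := hv
  map_target' w hw := by
    have hw' : w.2.2 ≠ 0 := hw
    simp [hw']
  left_inv' v hv := by
    have hv' : v.z ≠ 0 := hv
    have ht : (v.x * v.y - μ) / v.z = v.t := by
      rw [div_eq_iff hv']
      linear_combination v.eqn
    simp [hv', ht]
  right_inv' w hw := by
    have hw' : w.2.2 ≠ 0 := hw
    simp [hw']
  open_source := isOpen_ne_fun (by fun_prop) continuous_const
  open_target := isOpen_ne_fun (by fun_prop) continuous_const
  continuousOn_toFun := Continuous.continuousOn (by fun_prop)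
  continuousOn_invFun := by
    rw [isInducing_incl.continuousOn_iff]
    have : ContinuousOn (fun w : ℂ × ℂ × ℂ =>
        ((w.1, w.2.1, w.2.2, (w.1 * w.2.1 - μ) / w.2.2) : ℂ × ℂ × ℂ × ℂ)) {w | w.2.2 ≠ 0} := by
      fun_prop (disch := exact fun w hw => hw)
    refine this.congr fun w hw => ?_
    have hw' : w.2.2 ≠ 0 := hw
    simp [incl, hw']

theorem z_ne_zero [hμ : Fact (0 < μ)] {v : Conifold μ} (h : v.x = 0) : v.z ≠ 0 := by
  intro hz
  have := v.eqn
  rw [h, hz] at this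
  exact hμ.out.ne (by exact_mod_cast (by simpa using this : (0 : ℂ) = μ))

open Classical in
/-- For `μ > 0` the two charts cover the deformed conifold. -/
instance [hμ : Fact (0 < μ)] : ChartedSpace (ℂ × ℂ × ℂ) (Conifold μ) where
  atlas := {chartX μ, chartZ μ}
  chartAt v := if v.x = 0 then chartZ μ else chartX μ
  mem_chart_source v := by
    split_ifs with h
    · exact z_ne_zero h
    · exact h
  chart_mem_atlas v := by
    split_ifs <;> simp

theorem contDiffOn_incl_chartX_symm :
    ContDiffOn ℝ ∞ (incl ∘ (chartX μ).symm) (chartX μ).target := by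
  have : ContDiffOn ℝ ∞ (fun w : ℂ × ℂ × ℂ =>
      ((w.1, (μ + w.2.1 * w.2.2) / w.1, w.2.1, w.2.2) : ℂ × ℂ × ℂ × ℂ)) {w | w.1 ≠ 0} := by
    simp only [div_eq_mul_inv]
    have h : ContDiffOn ℝ ∞ (fun w : ℂ × ℂ × ℂ => w.1⁻¹) {w | w.1 ≠ 0} :=
      ContDiffOn.inv (by fun_prop) fun w hw => hw
    fun_prop
  refine this.congr fun w hw => ?_
  have hw' : w.1 ≠ 0 := hw
  simp [incl, chartX, hw']

theorem contDiffOn_incl_chartZ_symm :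
    ContDiffOn ℝ ∞ (incl ∘ (chartZ μ).symm) (chartZ μ).target := by
  have : ContDiffOn ℝ ∞ (fun w : ℂ × ℂ × ℂ =>
      ((w.1, w.2.1, w.2.2, (w.1 * w.2.1 - μ) / w.2.2) : ℂ × ℂ × ℂ × ℂ)) {w | w.2.2 ≠ 0} := by
    simp only [div_eq_mul_inv]
    have h : ContDiffOn ℝ ∞ (fun w : ℂ × ℂ × ℂ => w.2.2⁻¹) {w | w.2.2 ≠ 0} :=
      ContDiffOn.inv (by fun_prop) fun w hw => hw
    fun_prop
  refine this.congr fun w hw => ?_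
  have hw' : w.2.2 ≠ 0 := hw
  simp [incl, chartZ, hw']

/-- Each chart is the restriction of a linear map on `ℂ⁴`. -/
theorem exists_linear_of_mem_atlas [Fact (0 < μ)]
    {e : OpenPartialHomeomorph (Conifold μ) (ℂ × ℂ × ℂ)}
    (he : e ∈ atlas (ℂ × ℂ × ℂ) (Conifold μ)) :
    ∃ L : ℂ × ℂ × ℂ × ℂ → ℂ × ℂ × ℂ, ContDiff ℝ ∞ L ∧ ∀ v, e v = L v.incl := by
  rcases he with rfl | rfl
  · exact ⟨fun w => (w.1, w.2.2.1, w.2.2.2), by fun_prop, fun v => rfl⟩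
  · exact ⟨fun w => (w.1, w.2.1, w.2.2.1), by fun_prop, fun v => rfl⟩

theorem contDiffOn_incl_symm_of_mem_atlas [Fact (0 < μ)]
    {e : OpenPartialHomeomorph (Conifold μ) (ℂ × ℂ × ℂ)}
    (he : e ∈ atlas (ℂ × ℂ × ℂ) (Conifold μ)) :
    ContDiffOn ℝ ∞ (incl ∘ e.symm) e.target := by
  rcases he with rfl | rfl
  · exact contDiffOn_incl_chartX_symm
  · exact contDiffOn_incl_chartZ_symm

/-- The deformed conifold is a smooth manifold (of real dimension `6`). -/
instance [Fact (0 < μ)] : IsManifold 𝓘(ℝ, ℂ × ℂ × ℂ) ∞ (Conifold μ) := by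
  apply isManifold_of_contDiffOn
  intro e e' he he'
  obtain ⟨L, hL, hLe⟩ := exists_linear_of_mem_atlas he'
  refine ContDiffOn.congr (f := L ∘ incl ∘ e.symm)
    (hL.comp_contDiffOn ((contDiffOn_incl_symm_of_mem_atlas he).mono ?_)) ?_
  · intro w hw
    exact hw.1.1
  · intro w _
    simp [hLe]

/-- The inclusion into `ℂ⁴` is smooth. -/
theorem contMDiff_incl [Fact (0 < μ)] :
    ContMDiff 𝓘(ℝ, ℂ × ℂ × ℂ) 𝓘(ℝ, ℂ × ℂ × ℂ × ℂ) ∞ (incl (μ := μ)) := by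
  intro v
  rw [contMDiffAt_iff_source]
  have h := (contDiffOn_incl_symm_of_mem_atlas
    (chart_mem_atlas (ℂ × ℂ × ℂ) v)).contDiffAt
    ((chartAt (ℂ × ℂ × ℂ) v).open_target.mem_nhds (mem_chart_target _ v))
  exact h.contMDiffAt.contMDiffWithinAt

/-- The smooth structure is that of a submanifold of `ℂ⁴`: a map into the deformed conifold is
smooth if and only if it is smooth as a map into `ℂ⁴`. -/
theorem contMDiff_iff_incl [Fact (0 < μ)] {E H M : Type*} [NormedAddCommGroup E]
    [NormedSpace ℝ E] [TopologicalSpace H] {I : ModelWithCorners ℝ E H} [TopologicalSpace M]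
    [ChartedSpace H M] {f : M → Conifold μ} :
    ContMDiff I 𝓘(ℝ, ℂ × ℂ × ℂ) ∞ f ↔ ContMDiff I 𝓘(ℝ, ℂ × ℂ × ℂ × ℂ) ∞ (incl ∘ f) := by
  refine ⟨fun h => contMDiff_incl.comp h, fun h m => ?_⟩
  rw [contMDiffAt_iff_target]
  refine ⟨isInducing_incl.continuousAt_iff.2 (h m).continuousAt, ?_⟩
  obtain ⟨L, hL, hLe⟩ := exists_linear_of_mem_atlas (chart_mem_atlas (ℂ × ℂ × ℂ) (f m))
  have h' : ContMDiffAt I 𝓘(ℝ, ℂ × ℂ × ℂ) ∞ (L ∘ (incl ∘ f)) m :=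
    hL.contMDiff.contMDiffAt.comp m (h m)
  refine h'.congr_of_eventuallyEq (Filter.Eventually.of_forall fun x => ?_)
  simp [hLe]

open CyclicGp in
/-- The action `ω · (x, y, z, t) = (ω x, ω⁻¹ y, ω^q z, ω^(-q) t)` of `ℤ_p`. -/
instance (p q : ℕ) : MulAction (CyclicGp p q) (Conifold μ) where
  smul g v := ⟨toComplex g * v.x, (toComplex g)⁻¹ * v.y, toComplex g ^ q * v.z,
    (toComplex g ^ q)⁻¹ * v.t, by
      rw [← v.eqn, mul_mul_mul_comm, mul_mul_mul_comm _ v.z, mul_inv_cancel₀ (toComplex_ne_zero g),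
        mul_inv_cancel₀ (pow_ne_zero q (toComplex_ne_zero g)), one_mul, one_mul]⟩
  one_smul v := by
    change Conifold.mk _ _ _ _ _ = v
    ext <;> simp
  mul_smul g h v := by
    change Conifold.mk _ _ _ _ _ = Conifold.mk _ _ _ _ _
    ext
    · change toComplex (g * h) * v.x = toComplex g * (toComplex h * v.x)
      rw [map_mul, mul_assoc]
    · change (toComplex (g * h))⁻¹ * v.y = (toComplex g)⁻¹ * ((toComplex h)⁻¹ * v.y)
      rw [map_mul, mul_inv, mul_assoc]
    · change toComplex (g * h) ^ q * v.z = toComplex g ^ q * (toComplex h ^ q * v.z)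
      rw [map_mul, mul_pow, mul_assoc]
    · change (toComplex (g * h) ^ q)⁻¹ * v.t =
        (toComplex g ^ q)⁻¹ * ((toComplex h ^ q)⁻¹ * v.t)
      rw [map_mul, mul_pow, mul_inv, mul_assoc]

section Action

open CyclicGp

variable {p q : ℕ}

theorem incl_smul (g : CyclicGp p q) (v : Conifold μ) : (g • v).incl =
    (toComplex g * v.x, (toComplex g)⁻¹ * v.y, toComplex g ^ q * v.z,
      (toComplex g ^ q)⁻¹ * v.t) := rfl

instance : ContinuousConstSMul (CyclicGp p q) (Conifold μ) where
  continuous_const_smul g := by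
    rw [isInducing_incl.continuous_iff]
    change Continuous fun v : Conifold μ => (g • v).incl
    simp only [incl_smul]
    fun_prop

/-- The action is free. -/
instance [LensPair p q] [Fact (0 < μ)] : IsCancelSMul (CyclicGp p q) (Conifold μ) where
  right_cancel' g g' v h := by
    have h' : (g • v).incl = (g' • v).incl := congrArg incl h
    rw [incl_smul, incl_smul] at h'
    simp only [Prod.mk.injEq] at h'
    by_cases hx : v.x = 0
    · exact eq_of_pow_eq (mul_right_cancel₀ (z_ne_zero hx) h'.2.2.1)
    · exact toComplex_injective (mul_right_cancel₀ hx h'.1)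

theorem contMDiff_smul [Fact (0 < μ)] (g : CyclicGp p q) :
    ContMDiff 𝓘(ℝ, ℂ × ℂ × ℂ) 𝓘(ℝ, ℂ × ℂ × ℂ) ∞ (fun v : Conifold μ => g • v) := by
  rw [contMDiff_iff_incl]
  have h : ContDiff ℝ ∞ (fun w : ℂ × ℂ × ℂ × ℂ => ((toComplex g * w.1, (toComplex g)⁻¹ * w.2.1,
      toComplex g ^ q * w.2.2.1, (toComplex g ^ q)⁻¹ * w.2.2.2) : ℂ × ℂ × ℂ × ℂ)) := by
    fun_prop
  exact h.contMDiff.comp contMDiff_incl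

end Action

end Conifold

/-- The orbit space of the action of `ℤ_p` on the deformed conifold. -/
abbrev ConifoldQuotient (p q : ℕ) (μ : ℝ) : Type :=
  MulAction.orbitRel.Quotient (CyclicGp p q) (Conifold μ)

instance (p q : ℕ) (μ : ℝ) [LensPair p q] [Fact (0 < μ)] :
    IsManifold 𝓘(ℝ, ℂ × ℂ × ℂ) ∞ (ConifoldQuotient p q μ) :=
  isManifold_orbitSpace _ Conifold.contMDiff_smul

/-! ## Lens spaces -/

/-- The unit sphere in `ℂ²`. -/
abbrev S3 : Type := Metric.sphere (0 : EuclideanSpace ℂ (Fin 2)) 1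

instance : Fact (Module.finrank ℝ (EuclideanSpace ℂ (Fin 2)) = 3 + 1) := ⟨by
  rw [← Module.finrank_mul_finrank ℝ ℂ, Complex.finrank_real_complex, finrank_euclideanSpace_fin]⟩

namespace S3

open CyclicGp

variable {p q : ℕ}

/-- The linear map `(x, z) ↦ (ω x, ω^q z)` of `ℂ²`. -/
def rot (g : CyclicGp p q) (v : EuclideanSpace ℂ (Fin 2)) : EuclideanSpace ℂ (Fin 2) :=
  !₂[toComplex g * v 0, toComplex g ^ q * v 1]

theorem norm_rot [LensPair p q] (g : CyclicGp p q) (v : EuclideanSpace ℂ (Fin 2)) :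
    ‖rot g v‖ = ‖v‖ := by
  simp [EuclideanSpace.norm_eq, rot, norm_toComplex]

/-- The action `ω · (x, z) = (ω x, ω^q z)` of `ℤ_p` on the unit sphere in `ℂ²`. -/
instance [LensPair p q] : MulAction (CyclicGp p q) S3 where
  smul g v := ⟨rot g v.1, by
    rw [mem_sphere_zero_iff_norm, norm_rot]; exact mem_sphere_zero_iff_norm.1 v.2⟩
  one_smul v := by
    apply Subtype.ext
    change rot _ _ = _
    ext i
    fin_cases i <;> simp [rot]
  mul_smul g h v := by
    apply Subtype.ext
    change rot _ _ = rot _ (rot _ _)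
    ext i
    fin_cases i <;> simp [rot, mul_pow, mul_assoc]

theorem coe_smul [LensPair p q] (g : CyclicGp p q) (v : S3) : (g • v).1 = rot g v.1 := rfl

theorem contDiff_rot (g : CyclicGp p q) : ContDiff ℝ ∞ (rot g) := by
  rw [contDiff_piLp]
  intro i
  fin_cases i <;> simp [rot] <;> fun_prop

theorem contMDiff_smul [LensPair p q] (g : CyclicGp p q) :
    ContMDiff (𝓡 3) (𝓡 3) ∞ (fun v : S3 => g • v) :=
  ((contDiff_rot g).contMDiff.comp contMDiff_coe_sphere).codRestrict_sphere
    fun v => (g • v).2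

instance [LensPair p q] : ContinuousConstSMul (CyclicGp p q) S3 where
  continuous_const_smul g := (contMDiff_smul g).continuous

/-- The action is free. -/
instance [LensPair p q] : IsCancelSMul (CyclicGp p q) S3 where
  right_cancel' g g' v h := by
    have h' : rot g v.1 = rot g' v.1 := congrArg Subtype.val h
    have h0 : toComplex g * v.1 0 = toComplex g' * v.1 0 := by
      simpa [rot] using congrArg (fun w => w 0) h'
    have h1 : toComplex g ^ q * v.1 1 = toComplex g' ^ q * v.1 1 := by
      simpa [rot] using congrArg (fun w => w 1) h'
    by_cases hx : v.1 0 = 0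
    · have hz : v.1 1 ≠ 0 := by
        intro hz
        have : ‖v.1‖ = 1 := mem_sphere_zero_iff_norm.1 v.2
        rw [EuclideanSpace.norm_eq] at this
        simp [hx, hz] at this
      exact eq_of_pow_eq (mul_right_cancel₀ hz h1)
    · exact toComplex_injective (mul_right_cancel₀ hx h0)

end S3

/-- The lens space `L(p, q)`: the orbit space of the unit sphere in `ℂ²` under the action
`ω · (x, z) = (ω x, ω^q z)` of the `p`-th roots of unity. -/
abbrev LensSpace (p q : ℕ) [LensPair p q] : Type :=
  MulAction.orbitRel.Quotient (CyclicGp p q) S3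

instance (p q : ℕ) [LensPair p q] : IsManifold (𝓡 3) ∞ (LensSpace p q) :=
  isManifold_orbitSpace _ S3.contMDiff_smul

/-- The total space of the cotangent bundle of a smooth manifold: the bundle of continuous linear
maps from the tangent bundle to the trivial line bundle. -/
abbrev CotangentBundle {E H : Type*} [NormedAddCommGroup E] [NormedSpace ℝ E]
    [TopologicalSpace H] (I : ModelWithCorners ℝ E H) (M : Type*) [TopologicalSpace M]
    [ChartedSpace H M] [IsManifold I ∞ M] : Type _ :=
  Bundle.TotalSpace (E →L[ℝ] ℝ) (fun m : M => TangentSpace I m →L[ℝ] Bundle.Trivial M ℝ m)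

end

/-! Put `u = (x + ȳ, z - t̄)/2` and `w = -i(x - ȳ, z + t̄)/2`, which are `base` and `fiber` below.
Then `xy - zt = |u|² - |w|² + 2i⟨w, u⟩`, with the real inner product of `ℂ²`, so the conifold is the
set of pairs with `w ⊥ u` and `|u|² = μ + |w|²`. As `μ > 0`, `u` never vanishes and `(u/|u|, w)` is
a tangent vector of the sphere; conversely a unit vector `v` and `w ⊥ v` determine `u = √(μ + |w|²)
v`. Thus the conifold is `TS³`. Since `|ω| = 1`, both `u` and `w` transform by the isometry `rot`,
so the identification descends to orbit spaces, and the invariant round metric turns tangent vectors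
into covectors on the lens space.

The tangent bundle of the sphere is never formed: a point of `T*L` is represented by a unit vector
`v` and an ambient vector `w ⊥ v`. The passage between the two uses the derivatives of a local
section `L → ℂ²` (`dLift`) and of the projection `ℂ² ∖ 0 → L` (`dRadial`). Their composites are the
identity (`dRadial_dLift`) and the orthogonal projection to `v^⊥` (`dLift_dRadial`), so `covector`
and `codual` are mutually inverse on `v^⊥`. Smoothness in the two directions rests on
`contMDiffAt_cotangent` and `contMDiffAt_codual`. -/

noncomputable section

/-! ### Orbit spaces: the projection and its smooth local sections. -/

section OrbitSpace

set_option linter.unusedSectionVars false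

open MulAction

variable {E H M G : Type*} [NormedAddCommGroup E] [NormedSpace ℝ E] [TopologicalSpace H]
  [TopologicalSpace M] [ChartedSpace H M] [Group G] [MulAction G M]
  [ProperlyDiscontinuousSMul G M] [ContinuousConstSMul G M] [IsCancelSMul G M]
  [T2Space M] [LocallyCompactSpace M]

/-- The projection to the orbit space. -/
def orbitMk (G : Type*) {M : Type*} [Group G] [MulAction G M] (x : M) : orbitRel.Quotient G M :=
  Quotient.mk (orbitRel G M) x

theorem orbitMk_surjective : Function.Surjective (orbitMk G : M → orbitRel.Quotient G M) :=
  Quotient.mk_surjective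

theorem orbitMk_eq_iff {x y : M} : orbitMk G x = orbitMk G y ↔ ∃ g : G, g • y = x := by
  rw [orbitMk, orbitMk, Quotient.eq]
  rfl

@[simp]
theorem orbitMk_smul (g : G) (x : M) : orbitMk G (g • x) = orbitMk G x :=
  orbitMk_eq_iff.2 ⟨g, rfl⟩

theorem isLocalHomeomorph_orbitMk : IsLocalHomeomorph (orbitMk G : M → orbitRel.Quotient G M) :=
  (isQuotientCoveringMap_quotientMk_of_properlyDiscontinuousSMul (G := G)
    (E := M)).isCoveringMap.isLocalHomeomorph

/-- A local inverse through `a` of the projection to the orbit space. -/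
def orbitSection (G : Type*) {M : Type*} [TopologicalSpace M] [Group G] [MulAction G M]
    [ProperlyDiscontinuousSMul G M] [ContinuousConstSMul G M] [IsCancelSMul G M]
    [T2Space M] [LocallyCompactSpace M] (a : M) :
    OpenPartialHomeomorph (orbitRel.Quotient G M) M :=
  (isLocalHomeomorph_orbitMk (G := G) (M := M)).localInverseAt a

@[simp]
theorem orbitSection_orbitMk (a : M) : orbitSection G a (orbitMk G a) = a :=
  isLocalHomeomorph_orbitMk.localInverseAt_apply_self

theorem orbitMk_mem_orbitSection_source (a : M) : orbitMk G a ∈ (orbitSection G a).source :=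
  isLocalHomeomorph_orbitMk.apply_self_mem_localInverseAt_source

theorem self_mem_orbitSection_target (a : M) : a ∈ (orbitSection G a).target :=
  isLocalHomeomorph_orbitMk.self_mem_localInverseAt_target

theorem orbitMk_orbitSection (a : M) {m : orbitRel.Quotient G M}
    (hm : m ∈ (orbitSection G a).source) : orbitMk G (orbitSection G a m) = m :=
  isLocalHomeomorph_orbitMk.apply_localInverseAt_of_mem hm

theorem eventually_orbitMk_orbitSection (a : M) :
    ∀ᶠ m in nhds (orbitMk G a), orbitMk G (orbitSection G a m) = m :=
  Filter.eventually_of_mem ((orbitSection G a).open_source.mem_nhds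
    (orbitMk_mem_orbitSection_source a)) fun _ hm => orbitMk_orbitSection a hm

theorem orbitSection_symm (a : M) : ⇑(orbitSection G a).symm = orbitMk G :=
  isLocalHomeomorph_orbitMk.localInverseAt_symm a

theorem orbitSection_orbitMk_of_mem {a b : M} (hb : b ∈ (orbitSection G a).target) :
    orbitSection G a (orbitMk G b) = b := by
  rw [← orbitSection_symm a]
  exact (orbitSection G a).right_inv hb

theorem continuousAt_orbitSection (a : M) : ContinuousAt (orbitSection G a) (orbitMk G a) :=
  (orbitSection G a).continuousAt (orbitMk_mem_orbitSection_source a)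

/-- Two continuous local sections of the projection with the same value at a point agree nearby. -/
theorem eventually_eq_orbitSection {a : M} {s : orbitRel.Quotient G M → M}
    (hs : ContinuousAt s (orbitMk G a)) (hsa : s (orbitMk G a) = a)
    (h : ∀ᶠ m in nhds (orbitMk G a), orbitMk G (s m) = m) :
    ∀ᶠ m in nhds (orbitMk G a), s m = orbitSection G a m := by
  have h1 : ∀ᶠ m in nhds (orbitMk G a), s m ∈ (orbitSection G a).target :=
    hs.eventually ((orbitSection G a).open_target.mem_nhds
      (by rw [hsa]; exact self_mem_orbitSection_target a))
  filter_upwards [h, h1] with m hm hm1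
  rw [← orbitSection_orbitMk_of_mem hm1, hm]

theorem eventually_orbitSection_eq_of_mem {a b : M} (hb : b ∈ (orbitSection G a).target) :
    ∀ᶠ m in nhds (orbitMk G b), orbitSection G a m = orbitSection G b m := by
  have hs : orbitMk G b ∈ (orbitSection G a).source := by
    rw [← orbitSection_symm a]
    exact (orbitSection G a).map_target hb
  refine eventually_eq_orbitSection ((orbitSection G a).continuousAt hs)
    (orbitSection_orbitMk_of_mem hb) ?_
  filter_upwards [(orbitSection G a).open_source.mem_nhds hs] with m hm
  exact orbitMk_orbitSection a hm

/-- Both sides are continuous local sections through `g • a`, so uniqueness of such sections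
applies. -/
theorem eventually_smul_orbitSection (g : G) (a : M) :
    ∀ᶠ m in nhds (orbitMk G a), g • orbitSection G a m = orbitSection G (g • a) m := by
  have := eventually_eq_orbitSection (G := G) (a := g • a) (s := fun m => g • orbitSection G a m)
    (by rw [orbitMk_smul]; exact (continuousAt_orbitSection a).const_smul g) (by simp)
    (by simpa using eventually_orbitMk_orbitSection a)
  simpa using this

theorem eventually_orbitSection_orbitMk (a : M) :
    ∀ᶠ b in nhds a, orbitSection G a (orbitMk G b) = b :=
  Filter.eventually_of_mem ((orbitSection G a).open_target.mem_nhds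
    (self_mem_orbitSection_target a)) fun _ hb => orbitSection_orbitMk_of_mem hb

variable {I : ModelWithCorners ℝ E H} [IsManifold I ∞ M]

/-- The representative used by the chart of the orbit space at `m`. -/
theorem exists_chartAt_orbitSpace_eq (m : orbitRel.Quotient G M) : ∃ b : M, orbitMk G b = m ∧
    chartAt H m = (orbitSection G b).trans (chartAt H b) :=
  ⟨_, (Quotient.mk_surjective (s := orbitRel G M)).hasRightInverse.choose_spec m, rfl⟩

/-- The projection to the orbit space is smooth. -/
theorem contMDiff_orbitMk (hG : ∀ g : G, ContMDiff I I ∞ (fun x : M => g • x)) :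
    ContMDiff I I ∞ (orbitMk G : M → orbitRel.Quotient G M) := by
  intro a
  have := isManifold_orbitSpace I hG
  obtain ⟨b, hb, he⟩ := exists_chartAt_orbitSpace_eq (H := H) (orbitMk G a)
  -- The chart below is built from a chosen representative, which is `g • a` for some `g`; in charts
  -- the projection therefore reads as the action of `g`.
  obtain ⟨g, rfl⟩ := orbitMk_eq_iff.1 hb
  have h1 : ContMDiffAt I I ∞ (fun x : M => chartAt H (g • a) (g • x)) a :=
    ((contMDiffOn_chart (I := I) (n := ∞)).contMDiffAt
      (chart_source_mem_nhds H (g • a))).comp a (hG g a)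
  have h2 : ContMDiffAt I I ∞ (chartAt H (orbitMk G a)).symm (chartAt H (g • a) (g • a)) := by
    refine (contMDiffOn_chart_symm (I := I) (n := ∞)).contMDiffAt
      ((chartAt H (orbitMk G a)).open_target.mem_nhds ?_)
    have := mem_chart_target H (orbitMk G a)
    rw [he] at this ⊢
    rw [← orbitMk_smul g a] at this
    simp only [OpenPartialHomeomorph.coe_trans, Function.comp_apply, orbitSection_orbitMk] at this
    exact this
  refine (h2.comp a h1).congr_of_eventuallyEq ?_
  filter_upwards [(continuous_const_smul g).continuousAt.eventually
    (chart_source_mem_nhds H (g • a))] with x hx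
  simp only [Function.comp_apply, he, OpenPartialHomeomorph.coe_trans_symm, orbitSection_symm]
  rw [(chartAt H (g • a)).left_inv hx, orbitMk_smul]

/-- The local inverses of the projection to the orbit space are smooth. -/
theorem contMDiffAt_orbitSection (hG : ∀ g : G, ContMDiff I I ∞ (fun x : M => g • x)) (a : M) :
    ContMDiffAt I I ∞ (orbitSection G a) (orbitMk G a) := by
  have := isManifold_orbitSpace I hG
  obtain ⟨b, hb, he⟩ := exists_chartAt_orbitSpace_eq (H := H) (orbitMk G a)
  obtain ⟨g, rfl⟩ := orbitMk_eq_iff.1 hb.symm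
  simp only [orbitMk_smul] at he ⊢
  have h1 : ContMDiffAt I I ∞ (chartAt H (orbitMk G b)) (orbitMk G b) :=
    (contMDiffOn_chart (I := I) (n := ∞)).contMDiffAt (chart_source_mem_nhds H _)
  have h2 : ContMDiffAt I I ∞ (chartAt H b).symm (chartAt H (orbitMk G b) (orbitMk G b)) := by
    refine (contMDiffOn_chart_symm (I := I) (n := ∞)).contMDiffAt
      ((chartAt H b).open_target.mem_nhds ?_)
    rw [he]
    simp
  -- The section through `b` is the chart downstairs followed by the inverse chart upstairs;
  -- applying `g` moves it to the section through `g • b`.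
  refine ((hG g _).comp _ (h2.comp _ h1)).congr_of_eventuallyEq ?_
  filter_upwards [eventually_smul_orbitSection g b,
    (continuousAt_orbitSection b).eventually
      (by rw [orbitSection_orbitMk]; exact chart_source_mem_nhds H b)] with m hm hm1
  rw [← hm]
  simp only [Function.comp_apply, he, OpenPartialHomeomorph.coe_trans]
  rw [(chartAt H b).left_inv hm1]

variable {E' H' N : Type*} [NormedAddCommGroup E'] [NormedSpace ℝ E'] [TopologicalSpace H']
  [TopologicalSpace N] [ChartedSpace H' N] {J : ModelWithCorners ℝ E' H'}

/-- A map out of the orbit space is smooth if its lift is. -/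
theorem contMDiff_of_comp_orbitMk (hG : ∀ g : G, ContMDiff I I ∞ (fun x : M => g • x))
    {f : orbitRel.Quotient G M → N} (hf : ContMDiff I J ∞ (f ∘ orbitMk G)) :
    ContMDiff I J ∞ f := by
  intro m
  obtain ⟨a, rfl⟩ := orbitMk_surjective m
  refine (ContMDiffAt.comp _ (by simpa using hf a)
    (contMDiffAt_orbitSection hG a)).congr_of_eventuallyEq ?_
  filter_upwards [eventually_orbitMk_orbitSection a] with m hm
  simp [hm]

end OrbitSpace

/-! ### Radial projection onto the unit sphere. -/

namespace S3

open CyclicGp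

/-- The real Euclidean space underlying `ℂ²`. -/
abbrev C2 : Type := EuclideanSpace ℂ (Fin 2)

/-- Restricting the codomain to the sphere preserves smoothness at a point of an open set on which
the map takes values in the sphere. -/
theorem contMDiffAt_of_coe {E H M : Type*} [NormedAddCommGroup E] [NormedSpace ℝ E]
    [TopologicalSpace H] {I : ModelWithCorners ℝ E H} [TopologicalSpace M] [ChartedSpace H M]
    [IsManifold I ∞ M] {f : M → S3} {x : M} {U : Set M} (hU : IsOpen U) (hx : x ∈ U)
    (hf : ContMDiffOn I 𝓘(ℝ, C2) ∞ (fun y => (f y : C2)) U) : ContMDiffAt I (𝓡 3) ∞ f x := by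
  -- Restriction of the codomain to the sphere applies to globally smooth maps, so `U` is treated as
  -- a manifold in its own right.
  let W : TopologicalSpace.Opens M := ⟨U, hU⟩
  have h : ContMDiff I 𝓘(ℝ, C2) ∞ (fun y : W => (f y : C2)) := fun y =>
    contMDiffAt_subtype_iff.2 (hf.contMDiffAt (hU.mem_nhds y.2))
  have h' : ContMDiff I (𝓡 3) ∞ (fun y : W => f y) :=
    h.codRestrict_sphere fun y => (f y).2
  exact contMDiffAt_subtype_iff (x := (⟨x, hx⟩ : W)).1 (h' _)

/-- Radial projection to the unit sphere (with a junk value at the origin). -/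
def normalize (v : C2) : S3 :=
  if h : v = 0 then ⟨EuclideanSpace.single 0 1, by simp⟩ else
    ⟨‖v‖⁻¹ • v, by simp [norm_smul, h]⟩

theorem coe_normalize {v : C2} (h : v ≠ 0) : (normalize v : C2) = ‖v‖⁻¹ • v := by
  simp [normalize, h]

theorem contMDiffAt_normalize {v : C2} (h : v ≠ 0) :
    ContMDiffAt 𝓘(ℝ, C2) (𝓡 3) ∞ normalize v := by
  refine contMDiffAt_of_coe (U := {0}ᶜ) isOpen_compl_singleton h ?_
  refine (ContDiffOn.contMDiffOn (f := fun w : C2 => ‖w‖⁻¹ • w) ?_).congr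
    fun w hw => coe_normalize hw
  intro w hw
  exact (((contDiffAt_norm ℝ hw).inv (norm_ne_zero_iff.2 hw)).smul contDiffAt_id).contDiffWithinAt

theorem coe_ne_zero (v : S3) : (v : C2) ≠ 0 := ne_zero_of_mem_unit_sphere v

@[simp]
theorem normalize_coe (v : S3) : normalize v = v := by
  apply Subtype.ext
  simp [coe_normalize (coe_ne_zero v)]

/-- The derivative of the radial projection at a point of the unit sphere is the orthogonal
projection to the tangent space. -/
theorem hasFDerivAt_normalize (v : S3) :
    HasFDerivAt (fun w : C2 => (normalize w : C2))
      (ContinuousLinearMap.id ℝ C2 - (innerSL ℝ (v : C2)).smulRight (v : C2)) v := by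
  have hv : ‖(v : C2)‖ = 1 := by simp
  have hd : HasFDerivAt (fun w : C2 => ‖w‖) (innerSL ℝ (v : C2)) (v : C2) := by
    -- The norm is differentiated as the square root of its square; at a unit vector the factors `2`
    -- and `1/2` cancel.
    have h1 : HasFDerivAt (fun w : C2 => ‖w‖ ^ 2) (2 • innerSL ℝ (v : C2)) (v : C2) :=
      (hasStrictFDerivAt_norm_sq (v : C2)).hasFDerivAt
    have h2 := h1.sqrt (by simp)
    simp only [norm_nonneg, Real.sqrt_sq, hv] at h2
    convert! h2 using 1
    ext w
    simp
  have h3 := (hasDerivAt_inv (x := ‖(v : C2)‖) (by simp)).comp_hasFDerivAt (v : C2) hd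
  have h4 := h3.smul (hasFDerivAt_id (v : C2))
  refine (h4.congr_of_eventuallyEq ?_).congr_fderiv ?_
  · filter_upwards [isOpen_compl_singleton.mem_nhds (coe_ne_zero v)] with w hw
    simp [coe_normalize hw]
  · ext1 w
    simp [sub_eq_add_neg]

end S3

/-! ### Tangent vectors and covectors of the lens space, represented in `ℂ²`. -/

namespace LensSpace

open S3

variable {p q : ℕ} [LensPair p q]

/-- The projection of the punctured `ℂ²` to the lens space. -/
def radial (p q : ℕ) [LensPair p q] (v : C2) : LensSpace p q := orbitMk _ (normalize v)

@[simp]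
theorem radial_coe (v : S3) : radial p q v = orbitMk _ v := by simp [radial]

theorem contMDiffAt_radial {v : C2} (h : v ≠ 0) :
    ContMDiffAt 𝓘(ℝ, C2) (𝓡 3) ∞ (radial p q) v :=
  (contMDiff_orbitMk S3.contMDiff_smul _).comp v (contMDiffAt_normalize h)

/-- A local section through `v` of the projection of the punctured `ℂ²` to the lens space. -/
def lift (p q : ℕ) [LensPair p q] (v : S3) (m : LensSpace p q) : C2 :=
  orbitSection (CyclicGp p q) v m

@[simp]
theorem lift_orbitMk (v : S3) : lift p q v (orbitMk _ v) = v := by simp [lift]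

theorem contMDiffAt_lift (v : S3) :
    ContMDiffAt (𝓡 3) 𝓘(ℝ, C2) ∞ (lift p q v) (orbitMk _ v) :=
  (contMDiff_coe_sphere _).comp _ (contMDiffAt_orbitSection S3.contMDiff_smul v)

/-- The derivative at `v` of the projection to the lens space. -/
def dRadial (p q : ℕ) [LensPair p q] (v : S3) : C2 →L[ℝ] EuclideanSpace ℝ (Fin 3) :=
  mfderiv 𝓘(ℝ, C2) (𝓡 3) (radial p q) (v : C2)

/-- The derivative of the local section through `v`. -/
def dLift (p q : ℕ) [LensPair p q] (v : S3) : EuclideanSpace ℝ (Fin 3) →L[ℝ] C2 :=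
  mfderiv (𝓡 3) 𝓘(ℝ, C2) (lift p q v) (orbitMk _ v)

theorem mdifferentiableAt_lift (v : S3) :
    MDifferentiableAt (𝓡 3) 𝓘(ℝ, C2) (lift p q v) (orbitMk _ v) :=
  (contMDiffAt_lift v).mdifferentiableAt (by simp)

theorem mdifferentiableAt_radial (v : S3) :
    MDifferentiableAt 𝓘(ℝ, C2) (𝓡 3) (radial p q) (v : C2) :=
  (contMDiffAt_radial (coe_ne_zero v)).mdifferentiableAt (by simp)

/-- Chain rule for `radial ∘ lift`, which is the identity near the class of `v`. -/
theorem dRadial_dLift (v : S3) (η : EuclideanSpace ℝ (Fin 3)) :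
    dRadial p q v (dLift p q v η) = η := by
  have h1 : HasMFDerivAt 𝓘(ℝ, C2) (𝓡 3) (radial p q) (lift p q v (orbitMk _ v))
      (dRadial p q v) := by
    rw [lift_orbitMk]; exact (mdifferentiableAt_radial v).hasMFDerivAt
  have h2 := h1.comp _ (mdifferentiableAt_lift v).hasMFDerivAt
  have h3 : HasMFDerivAt (𝓡 3) (𝓡 3) (radial p q ∘ lift p q v) (orbitMk _ v)
      (ContinuousLinearMap.id ℝ (TangentSpace (𝓡 3) (orbitMk (CyclicGp p q) v))) := by
    refine (hasMFDerivAt_id _).congr_of_eventuallyEq ?_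
    filter_upwards [eventually_orbitMk_orbitSection v] with m hm
    simp [lift, hm]
  exact congrArg (fun L : EuclideanSpace ℝ (Fin 3) →L[ℝ] EuclideanSpace ℝ (Fin 3) => L η)
    (hasMFDerivAt_unique h2 h3)

theorem dLift_dRadial (v : S3) (w : C2) :
    dLift p q v (dRadial p q v w) = w - inner ℝ (v : C2) w • (v : C2) := by
  have h1 : HasMFDerivAt (𝓡 3) 𝓘(ℝ, C2) (lift p q v) (radial p q (v : C2)) (dLift p q v) := by
    rw [radial_coe]; exact (mdifferentiableAt_lift v).hasMFDerivAt
  have h2 := h1.comp _ (mdifferentiableAt_radial v).hasMFDerivAt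
  have h3 : HasMFDerivAt 𝓘(ℝ, C2) 𝓘(ℝ, C2) (lift p q v ∘ radial p q) (v : C2)
      (ContinuousLinearMap.id ℝ C2 - (innerSL ℝ (v : C2)).smulRight (v : C2)) := by
    -- Near `v`, `lift ∘ radial` is the radial projection to the sphere, because the local section
    -- inverts the quotient map there.
    refine (hasFDerivAt_normalize v).hasMFDerivAt.congr_of_eventuallyEq ?_
    have hc : ContinuousAt normalize (v : C2) :=
      (contMDiffAt_normalize (coe_ne_zero v)).continuousAt
    have := eventually_orbitSection_orbitMk (G := CyclicGp p q) v
    rw [← normalize_coe v] at this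
    filter_upwards [hc.eventually this] with w hw
    simpa [lift, radial] using congrArg Subtype.val hw
  have h4 := congrArg (fun L : C2 →L[ℝ] C2 => L w) (hasMFDerivAt_unique h2 h3)
  simpa using! h4

theorem dRadial_self (v : S3) : dRadial p q v v = 0 := by
  have h := dRadial_dLift (p := p) (q := q) v (dRadial p q v v)
  rw [dLift_dRadial] at h
  simpa using h.symm

/-- The linear map underlying the action on the sphere. -/
def rotL (g : CyclicGp p q) : C2 →L[ℝ] C2 :=
  LinearMap.toContinuousLinearMap
    { toFun := rot g
      map_add' := fun v w => by ext i; fin_cases i <;> simp [rot, mul_add]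
      map_smul' := fun c v => by ext i; fin_cases i <;> simp [rot] <;> ring }

omit [LensPair p q] in
@[simp]
theorem rotL_apply (g : CyclicGp p q) (v : C2) : rotL g v = rot g v := rfl

theorem inner_rot (g : CyclicGp p q) (v w : C2) :
    inner ℝ (rot g v) (rot g w) = inner ℝ v w := by
  have h : ∀ u, ‖rotL g u‖ = ‖u‖ := norm_rot g
  exact LinearIsometry.inner_map_map ⟨(rotL g).toLinearMap, h⟩ v w

/-- The section through `g • v` is `rot g` applied to the section through `v`, and `rot g` is
linear. -/
theorem dLift_smul (g : CyclicGp p q) (v : S3) (η : EuclideanSpace ℝ (Fin 3)) :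
    dLift p q (g • v) η = rot g (dLift p q v η) := by
  have h1 : HasMFDerivAt 𝓘(ℝ, C2) 𝓘(ℝ, C2) (rotL g) (lift p q v (orbitMk _ v)) (rotL g) :=
    (rotL g).hasFDerivAt.hasMFDerivAt
  have h2 := h1.comp _ (mdifferentiableAt_lift v).hasMFDerivAt
  have h3 : HasMFDerivAt (𝓡 3) 𝓘(ℝ, C2) (lift p q (g • v)) (orbitMk _ v) (dLift p q (g • v)) := by
    have := (mdifferentiableAt_lift (p := p) (q := q) (g • v)).hasMFDerivAt
    rw [orbitMk_smul] at this
    convert! this using 1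
    rw [dLift, orbitMk_smul]
  have h4 := h3.congr_of_eventuallyEq (f₁ := rotL g ∘ lift p q v) (by
    filter_upwards [eventually_smul_orbitSection g v] with m hm
    simp only [lift, Function.comp_apply, ← hm]
    rfl)
  exact congrArg (fun L : EuclideanSpace ℝ (Fin 3) →L[ℝ] C2 => L η) (hasMFDerivAt_unique h4 h2)

/-- Near a point of the sphere, the derivative of the local sections is that of a single one. -/
theorem dLift_eq_of_mem {v₀ v : S3} (hv : v ∈ (orbitSection (CyclicGp p q) v₀).target) :
    dLift p q v = mfderiv (𝓡 3) 𝓘(ℝ, C2) (lift p q v₀) (orbitMk _ v) := by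
  refine Filter.EventuallyEq.mfderiv_eq ?_
  filter_upwards [eventually_orbitSection_eq_of_mem hv] with m hm
  simp [lift, hm]

theorem dRadial_smul (g : CyclicGp p q) (v : S3) (w : C2) :
    dRadial p q (g • v) (rot g w) = dRadial p q v w := by
  -- `dLift` is injective, with left inverse `dRadial`, so the equality may be tested in `ℂ²`.
  have h : dLift p q (g • v) (dRadial p q (g • v) (rot g w)) =
      dLift p q (g • v) (dRadial p q v w) := by
    rw [dLift_dRadial, dLift_smul, dLift_dRadial, coe_smul, inner_rot, ← rotL_apply,
      ← rotL_apply, ← rotL_apply, map_sub, map_smul]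
  rw [← dRadial_dLift (p := p) (q := q) (g • v) (dRadial p q (g • v) (rot g w)), h, dRadial_dLift]

/-- The tangent vector at `v` to the sphere that represents the pullback of the covector `ξ`. -/
def codual (p q : ℕ) [LensPair p q] (v : S3) (ξ : EuclideanSpace ℝ (Fin 3) →L[ℝ] ℝ) : C2 :=
  ∑ i, ξ (dRadial p q v (stdOrthonormalBasis ℝ C2 i)) • stdOrthonormalBasis ℝ C2 i

theorem inner_codual (v : S3) (ξ : EuclideanSpace ℝ (Fin 3) →L[ℝ] ℝ) (u : C2) :
    inner ℝ (codual p q v ξ) u = ξ (dRadial p q v u) := by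
  conv_rhs => rw [← (stdOrthonormalBasis ℝ C2).sum_repr' u]
  simp [codual, sum_inner, inner_smul_left, map_sum, mul_comm]

theorem inner_codual_self (v : S3) (ξ : EuclideanSpace ℝ (Fin 3) →L[ℝ] ℝ) :
    inner ℝ (codual p q v ξ) (v : C2) = 0 := by
  rw [inner_codual, dRadial_self, map_zero]

theorem codual_smul (g : CyclicGp p q) (v : S3) (ξ : EuclideanSpace ℝ (Fin 3) →L[ℝ] ℝ) :
    codual p q (g • v) ξ = rot g (codual p q v ξ) := by
  refine ext_inner_right ℝ fun u => ?_
  -- An injective linear endomorphism of a finite-dimensional space is surjective.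
  obtain ⟨u, rfl⟩ : ∃ u', rot g u' = u :=
    (LinearMap.injective_iff_surjective (f := (rotL g).toLinearMap)).1
      (LinearIsometry.injective ⟨(rotL g).toLinearMap, norm_rot g⟩) u
  rw [inner_codual, inner_rot, inner_codual, dRadial_smul]

/-- The covector at the image of `v` represented by `w`. -/
def covector (p q : ℕ) [LensPair p q] (v : S3) (w : C2) : EuclideanSpace ℝ (Fin 3) →L[ℝ] ℝ :=
  (innerSL ℝ w).comp (dLift p q v)

/-- For arbitrary `w` the result would be its component orthogonal to `v`. -/
theorem codual_covector {v : S3} {w : C2} (h : inner ℝ w (v : C2) = 0) :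
    codual p q v (covector p q v w) = w := by
  refine ext_inner_right ℝ fun u => ?_
  rw [inner_codual]
  simp [covector, dLift_dRadial, inner_sub_right, inner_smul_right, h]

theorem covector_codual (v : S3) (ξ : EuclideanSpace ℝ (Fin 3) →L[ℝ] ℝ) :
    covector p q v (codual p q v ξ) = ξ := by
  ext1 η
  simp [covector, inner_codual, dRadial_dLift]

theorem covector_smul (g : CyclicGp p q) (v : S3) (w : C2) :
    covector p q (g • v) (rot g w) = covector p q v w := by
  ext1 η
  simp [covector, dLift_smul, inner_rot]

/-- The covector represented by `w` as a point of the cotangent bundle. -/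
def cotangent (p q : ℕ) [LensPair p q] (v : S3) (w : C2) :
    CotangentBundle (𝓡 3) (LensSpace p q) :=
  ⟨orbitMk _ v, covector p q v w⟩

theorem cotangent_smul (g : CyclicGp p q) (v : S3) (w : C2) :
    cotangent p q (g • v) (rot g w) = cotangent p q v w := by
  -- Every fibre is the model space by definition, so a covector moves unchanged along an equality
  -- of base points.
  have h : ∀ m m' : LensSpace p q, m = m' → ∀ ξ : EuclideanSpace ℝ (Fin 3) →L[ℝ] ℝ,
      (⟨m, ξ⟩ : CotangentBundle (𝓡 3) (LensSpace p q)) = ⟨m', ξ⟩ := by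
    rintro m _ rfl ξ; rfl
  rw [cotangent, covector_smul]
  exact h _ _ (orbitMk_smul g v) _

/-! ### Smoothness of the passage between ambient vectors and covectors. -/

variable {E H N : Type*} [NormedAddCommGroup E] [NormedSpace ℝ E] [TopologicalSpace H]
  {I : ModelWithCorners ℝ E H} [TopologicalSpace N] [ChartedSpace H N] [IsManifold I ∞ N]

/-- The covector is the derivative in `m` of `⟨w y, lift m⟩`. With the section frozen at `v x` this
function is jointly smooth in `(y, m)`, so its partial derivative varies smoothly with `y`. -/
theorem contMDiffAt_cotangent {v : N → S3} {w : N → C2} {x : N}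
    (hv : ContMDiffAt I (𝓡 3) ∞ v x) (hw : ContMDiffAt I 𝓘(ℝ, C2) ∞ w x) :
    ContMDiffAt I ((𝓡 3).prod 𝓘(ℝ, EuclideanSpace ℝ (Fin 3) →L[ℝ] ℝ)) ∞
      (fun y => cotangent p q (v y) (w y)) x := by
  have hb : ContMDiffAt I (𝓡 3) ∞ (fun y => orbitMk (CyclicGp p q) (v y)) x :=
    (contMDiff_orbitMk S3.contMDiff_smul _).comp x hv
  rw [contMDiffAt_hom_bundle]
  refine ⟨hb, ?_⟩
  have hf : ContMDiffAt (I.prod (𝓡 3)) 𝓘(ℝ, ℝ) ∞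
      (Function.uncurry fun (y : N) (m : LensSpace p q) => inner ℝ (w y) (lift p q (v x) m))
      (x, orbitMk _ (v x)) := by
    have h1 : ContMDiffAt (I.prod (𝓡 3)) 𝓘(ℝ, C2) ∞
        (fun z : N × LensSpace p q => w z.1) (x, orbitMk _ (v x)) :=
      ContMDiffAt.comp (x, orbitMk _ (v x)) hw contMDiffAt_fst
    have h2 : ContMDiffAt (I.prod (𝓡 3)) 𝓘(ℝ, C2) ∞
        (fun z : N × LensSpace p q => lift p q (v x) z.2) (x, orbitMk _ (v x)) :=
      ContMDiffAt.comp (g := lift p q (v x)) (x, orbitMk _ (v x)) (contMDiffAt_lift (v x))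
        contMDiffAt_snd
    have hi : ContDiff ℝ ∞ (fun z : C2 × C2 => (inner ℝ z.1 z.2 : ℝ)) :=
      contDiff_fst.inner ℝ contDiff_snd
    have hi' : ContMDiff 𝓘(ℝ, C2 × C2) 𝓘(ℝ, ℝ) ∞ (fun z : C2 × C2 => (inner ℝ z.1 z.2 : ℝ)) :=
      hi.contMDiff
    exact ContMDiffAt.comp (g := fun z : C2 × C2 => (inner ℝ z.1 z.2 : ℝ))
      (f := fun z : N × LensSpace p q => (w z.1, lift p q (v x) z.2)) (x, orbitMk _ (v x))
      hi'.contMDiffAt (h1.prodMk_space h2)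
  have hd := ContMDiffAt.mfderiv (m := ∞) _ _ hf hb (by simp)
  refine hd.congr_of_eventuallyEq ?_
  -- For `y` near `x` the sections through `v x` and `v y` agree near the class of `v y`, hence have
  -- the same derivative there.
  filter_upwards [hv.continuousAt.eventually
    ((orbitSection (CyclicGp p q) (v x)).open_target.mem_nhds
      (self_mem_orbitSection_target (v x)))] with y hy
  have hdiff : MDifferentiableAt (𝓡 3) 𝓘(ℝ, C2) (lift p q (v x)) (orbitMk _ (v y)) := by
    refine ((mdifferentiableAt_lift (v y))).congr_of_eventuallyEq ?_
    filter_upwards [eventually_orbitSection_eq_of_mem hy] with m hm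
    simp [lift, hm]
  have key : covector p q (v y) (w y) = mfderiv (𝓡 3) 𝓘(ℝ, ℝ)
      (fun m : LensSpace p q => inner ℝ (w y) (lift p q (v x) m)) (orbitMk _ (v y)) := by
    have := ((innerSL ℝ (w y)).hasFDerivAt.hasMFDerivAt.comp _ hdiff.hasMFDerivAt).mfderiv
    rw [covector, dLift_eq_of_mem hy]
    exact this.symm
  -- Both sides use the same trivialization of the tangent bundle of the lens space; on the target,
  -- the trivial line bundle and the tangent bundle of `ℝ` have identity trivializations.
  unfold inTangentCoordinates
  beta_reduce
  rw [← key]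
  simp only [ContinuousLinearMap.inCoordinates]
  ext1 η
  simp only [cotangent, Bundle.Trivial.fiberBundle_trivializationAt',
    Bundle.Trivial.continuousLinearMapAt_trivialization, ContinuousLinearMap.id_comp,
    TangentBundle.continuousLinearMapAt_model_space]
  rfl

theorem contMDiffAt_dRadial_orbitSection (v : S3) (w : C2) :
    ContMDiffAt (𝓡 3) ((𝓡 3).prod 𝓘(ℝ, EuclideanSpace ℝ (Fin 3))) ∞
      (fun m : LensSpace p q => (⟨m, dRadial p q (orbitSection _ v m) w⟩ :
        TangentBundle (𝓡 3) (LensSpace p q))) (orbitMk _ v) := by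
  have h1 : ContMDiffOn 𝓘(ℝ, C2).tangent (𝓡 3).tangent ∞
      (tangentMapWithin 𝓘(ℝ, C2) (𝓡 3) (radial p q) {0}ᶜ)
      (Bundle.TotalSpace.proj ⁻¹' {0}ᶜ) := by
    have h : ContMDiffOn 𝓘(ℝ, C2) (𝓡 3) ∞ (radial p q) {0}ᶜ :=
      fun u hu => (contMDiffAt_radial hu).contMDiffWithinAt
    exact h.contMDiffOn_tangentMapWithin (by simp)
      isOpen_compl_singleton.uniqueMDiffOn
  -- The constant field `w` along the local section; the tangent map of `radial` carries it to the
  -- required field.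
  have h2 : ContMDiffAt (𝓡 3) 𝓘(ℝ, C2).tangent ∞
      (fun m : LensSpace p q => (⟨lift p q v m, w⟩ : TangentBundle 𝓘(ℝ, C2) C2))
      (orbitMk _ v) := by
    rw [Bundle.contMDiffAt_totalSpace]
    refine ⟨contMDiffAt_lift v, ?_⟩
    refine (contMDiffAt_const (c := w)).congr_of_eventuallyEq (.of_forall fun m => ?_)
    exact congrArg Prod.snd (trivializationAt_model_space_apply (I := 𝓘(ℝ, C2))
      (⟨lift p q v m, w⟩ : TangentBundle 𝓘(ℝ, C2) C2) _)
  have h3 := ContMDiffAt.comp (orbitMk _ v) (h1.contMDiffAt ?_) h2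
  · refine h3.congr_of_eventuallyEq ?_
    filter_upwards [eventually_orbitMk_orbitSection v] with m hm
    have h : ∀ m m' : LensSpace p q, m = m' → ∀ ξ : EuclideanSpace ℝ (Fin 3),
        (⟨m, ξ⟩ : TangentBundle (𝓡 3) (LensSpace p q)) = ⟨m', ξ⟩ := by
      rintro m _ rfl ξ; rfl
    have h4 : m = radial p q (lift p q v m) := by simp [lift, hm]
    simp only [Function.comp_apply, tangentMapWithin]
    rw [mfderivWithin_of_isOpen isOpen_compl_singleton]
    · exact h _ _ h4 _
    · exact coe_ne_zero _
  · exact (isOpen_compl_singleton.preimage (FiberBundle.continuous_proj _ _)).mem_nhds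
      (coe_ne_zero _)

/-- The coordinates in an orthonormal basis are pairings of the varying covector with the smooth
local vector fields `dRadial (section m) eᵢ`. -/
theorem contMDiffAt_codual {v : S3} (ξ : CotangentBundle (𝓡 3) (LensSpace p q))
    (hξ : ξ.proj = orbitMk _ v) :
    ContMDiffAt ((𝓡 3).prod 𝓘(ℝ, EuclideanSpace ℝ (Fin 3) →L[ℝ] ℝ)) 𝓘(ℝ, C2) ∞
      (fun ζ : CotangentBundle (𝓡 3) (LensSpace p q) =>
        codual p q (orbitSection _ v ζ.proj) ζ.2) ξ := by
  have hs : ∀ w : C2, ContMDiffAt ((𝓡 3).prod 𝓘(ℝ, EuclideanSpace ℝ (Fin 3) →L[ℝ] ℝ)) 𝓘(ℝ, ℝ) ∞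
      (fun ζ : CotangentBundle (𝓡 3) (LensSpace p q) =>
        (ζ.2 (dRadial p q (orbitSection _ v ζ.proj) w) : ℝ)) ξ := by
    intro w
    have h1 : ContMDiffAt ((𝓡 3).prod 𝓘(ℝ, EuclideanSpace ℝ (Fin 3) →L[ℝ] ℝ))
        ((𝓡 3).prod 𝓘(ℝ, EuclideanSpace ℝ (Fin 3))) ∞
        (fun ζ : CotangentBundle (𝓡 3) (LensSpace p q) =>
          (⟨ζ.proj, dRadial p q (orbitSection _ v ζ.proj) w⟩ :
            TangentBundle (𝓡 3) (LensSpace p q))) ξ :=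
      ContMDiffAt.comp ξ (by rw [hξ]; exact contMDiffAt_dRadial_orbitSection v w)
        (Bundle.contMDiffAt_proj _)
    have h2 := ContMDiffAt.clm_bundle_apply (n := ∞) (x := ξ)
      (ϕ := fun ζ : CotangentBundle (𝓡 3) (LensSpace p q) => ζ.2) contMDiffAt_id h1
    exact (Bundle.contMDiffAt_totalSpace.1 h2).2
  have h : ContMDiff 𝓘(ℝ, Fin (Module.finrank ℝ C2) → ℝ) 𝓘(ℝ, C2) ∞
      (fun c : Fin (Module.finrank ℝ C2) → ℝ => ∑ i, c i • stdOrthonormalBasis ℝ C2 i) :=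
    ContDiff.contMDiff (by fun_prop)
  exact h.contMDiffAt.comp ξ (contMDiffAt_pi_space.2 fun i => hs _)

end LensSpace

open S3 LensSpace CyclicGp

theorem S3.inner_eq (v w : C2) : inner ℝ v w =
    (v 0).re * (w 0).re + (v 0).im * (w 0).im + ((v 1).re * (w 1).re + (v 1).im * (w 1).im) := by
  simp [PiLp.inner_apply, Complex.inner]
  ring

theorem S3.norm_sq_eq (v : C2) : ‖v‖ ^ 2 =
    (v 0).re ^ 2 + (v 0).im ^ 2 + ((v 1).re ^ 2 + (v 1).im ^ 2) := by
  rw [← real_inner_self_eq_norm_sq, S3.inner_eq]; ring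

theorem S3.normalize_smul {p q : ℕ} [LensPair p q] (g : CyclicGp p q) {v : C2} (h : v ≠ 0) :
    normalize (rot g v) = g • normalize v := by
  have h' : rot g v ≠ 0 := by
    rw [← norm_ne_zero_iff, norm_rot]; exact norm_ne_zero_iff.2 h
  apply Subtype.ext
  rw [coe_smul, coe_normalize h, coe_normalize h', norm_rot, ← rotL_apply, ← rotL_apply, map_smul]

/-! ### The deformed conifold as pairs of orthogonal vectors in `ℂ²`. -/

namespace Conifold

variable {μ : ℝ}

/-- Smoothness at a point of a map into the deformed conifold can be checked in `ℂ⁴`. -/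
theorem contMDiffAt_of_incl [Fact (0 < μ)] {E H M : Type*} [NormedAddCommGroup E]
    [NormedSpace ℝ E] [TopologicalSpace H] {I : ModelWithCorners ℝ E H} [TopologicalSpace M]
    [ChartedSpace H M] {f : M → Conifold μ} {m : M}
    (h : ContMDiffAt I 𝓘(ℝ, ℂ × ℂ × ℂ × ℂ) ∞ (incl ∘ f) m) :
    ContMDiffAt I 𝓘(ℝ, ℂ × ℂ × ℂ) ∞ f m := by
  rw [contMDiffAt_iff_target]
  refine ⟨isInducing_incl.continuousAt_iff.2 h.continuousAt, ?_⟩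
  obtain ⟨L, hL, hLe⟩ := exists_linear_of_mem_atlas (chart_mem_atlas (ℂ × ℂ × ℂ) (f m))
  have h' : ContMDiffAt I 𝓘(ℝ, ℂ × ℂ × ℂ) ∞ (L ∘ (incl ∘ f)) m :=
    hL.contMDiff.contMDiffAt.comp m h
  refine h'.congr_of_eventuallyEq (Filter.Eventually.of_forall fun x => ?_)
  simp [hLe]

open ComplexConjugate

/-- The component of a point of the conifold along the compact real form. -/
def base (s : Conifold μ) : C2 := !₂[(s.x + conj s.y) / 2, (s.z - conj s.t) / 2]

/-- The component of a point of the conifold normal to the compact real form, rotated by `-i`. -/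
def fiber (s : Conifold μ) : C2 :=
  !₂[-Complex.I * ((s.x - conj s.y) / 2), -Complex.I * ((s.z + conj s.t) / 2)]

/-- This is the real part of the defining equation; `inner_fiber_base` is half its imaginary part.
-/
theorem norm_base_sq (s : Conifold μ) : ‖s.base‖ ^ 2 = μ + ‖s.fiber‖ ^ 2 := by
  have h := congrArg Complex.re s.eqn
  simp only [Complex.sub_re, Complex.mul_re, Complex.ofReal_re] at h
  rw [norm_sq_eq, norm_sq_eq]
  simp [base, fiber]
  linear_combination h

theorem inner_fiber_base (s : Conifold μ) : inner ℝ s.fiber s.base = 0 := by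
  have h := congrArg Complex.im s.eqn
  simp only [Complex.sub_im, Complex.mul_im, Complex.ofReal_im] at h
  rw [S3.inner_eq]
  simp [base, fiber]
  linear_combination h / 2

theorem base_ne_zero [hμ : Fact (0 < μ)] (s : Conifold μ) : s.base ≠ 0 := by
  intro h
  have := s.norm_base_sq
  rw [h, norm_zero] at this
  nlinarith [hμ.out, sq_nonneg ‖s.fiber‖]

theorem inner_fiber_normalize [Fact (0 < μ)] (s : Conifold μ) :
    inner ℝ s.fiber (normalize s.base : C2) = 0 := by
  rw [coe_normalize s.base_ne_zero, inner_smul_right, inner_fiber_base, mul_zero]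

/-- For `|ω| = 1` the conjugate of `ω⁻¹` is `ω`, so `ȳ` has the weight of `x` and `t̄` that of `z`.
-/
theorem base_smul {p q : ℕ} [LensPair p q] (g : CyclicGp p q) (s : Conifold μ) :
    (g • s).base = rot g s.base := by
  have hg : conj (toComplex g)⁻¹ = toComplex g := by
    rw [Complex.inv_eq_conj (norm_toComplex g), Complex.conj_conj]
  have h := incl_smul g s
  simp only [incl, Prod.mk.injEq] at h
  obtain ⟨hx, hy, hz, ht⟩ := h
  ext i
  fin_cases i
  · simp only [base, rot, hx, hy, map_mul, hg]
    simp; ring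
  · simp only [base, rot, hz, ht, map_mul, ← inv_pow, map_pow, hg]
    simp; ring

theorem fiber_smul {p q : ℕ} [LensPair p q] (g : CyclicGp p q) (s : Conifold μ) :
    (g • s).fiber = rot g s.fiber := by
  have hg : conj (toComplex g)⁻¹ = toComplex g := by
    rw [Complex.inv_eq_conj (norm_toComplex g), Complex.conj_conj]
  have h := incl_smul g s
  simp only [incl, Prod.mk.injEq] at h
  obtain ⟨hx, hy, hz, ht⟩ := h
  ext i
  fin_cases i
  · simp only [fiber, rot, hx, hy, map_mul, hg]
    simp; ring
  · simp only [fiber, rot, hz, ht, map_mul, ← inv_pow, map_pow, hg]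
    simp; ring

/-- The point of `ℂ⁴` with components `u` and `w`. -/
def ofComponents (u w : C2) : ℂ × ℂ × ℂ × ℂ :=
  (u 0 + Complex.I * w 0, conj (u 0 - Complex.I * w 0), u 1 + Complex.I * w 1,
    conj (Complex.I * w 1 - u 1))

/-- The point of the conifold whose fiber component is `w` and whose base component is in the
direction `v`. -/
def ofTangent [hμ : Fact (0 < μ)] (v : S3) (w : C2) (h : inner ℝ w (v : C2) = 0) : Conifold μ where
  x := (ofComponents (√(μ + ‖w‖ ^ 2) • (v : C2)) w).1
  y := (ofComponents (√(μ + ‖w‖ ^ 2) • (v : C2)) w).2.1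
  z := (ofComponents (√(μ + ‖w‖ ^ 2) • (v : C2)) w).2.2.1
  t := (ofComponents (√(μ + ‖w‖ ^ 2) • (v : C2)) w).2.2.2
  eqn := by
    have hc : √(μ + ‖w‖ ^ 2) ^ 2 = μ + ‖w‖ ^ 2 :=
      Real.sq_sqrt (by have := hμ.out; positivity)
    have hv : ‖(v : C2)‖ ^ 2 = 1 := by simp
    -- With `c` the square root, the real part is `c²‖v‖² - ‖w‖² = μ` and the imaginary part is
    -- `2c⟨w, v⟩ = 0`.
    generalize √(μ + ‖w‖ ^ 2) = c at hc
    rw [norm_sq_eq] at hc hv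
    rw [S3.inner_eq] at h
    apply Complex.ext
    · simp [ofComponents]
      linear_combination hc + c ^ 2 * hv
    · simp [ofComponents]
      linear_combination 2 * c * h

theorem base_ofTangent [Fact (0 < μ)] (v : S3) (w : C2) (h : inner ℝ w (v : C2) = 0) :
    (ofTangent (μ := μ) v w h).base = √(μ + ‖w‖ ^ 2) • (v : C2) := by
  ext i
  fin_cases i <;> simp [base, ofTangent, ofComponents] <;> ring

theorem fiber_ofTangent [Fact (0 < μ)] (v : S3) (w : C2) (h : inner ℝ w (v : C2) = 0) :
    (ofTangent (μ := μ) v w h).fiber = w := by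
  ext i
  fin_cases i
  · simp [fiber, ofTangent, ofComponents]
    linear_combination -(w 0) * Complex.I_mul_I
  · simp [fiber, ofTangent, ofComponents]
    linear_combination -(w 1) * Complex.I_mul_I

theorem normalize_base_ofTangent [hμ : Fact (0 < μ)] (v : S3) (w : C2)
    (h : inner ℝ w (v : C2) = 0) : normalize (ofTangent (μ := μ) v w h).base = v := by
  apply Subtype.ext
  have hc : 0 < √(μ + ‖w‖ ^ 2) := Real.sqrt_pos.2 (by have := hμ.out; positivity)
  rw [coe_normalize (base_ne_zero _), base_ofTangent, norm_smul, norm_eq_of_mem_sphere, mul_one,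
    Real.norm_of_nonneg hc.le, smul_smul, inv_mul_cancel₀ hc.ne', one_smul]

theorem ext_components {s s' : Conifold μ} (hb : s.base = s'.base) (hf : s.fiber = s'.fiber) :
    s = s' := by
  have h : ∀ r : Conifold μ, r.incl = ofComponents r.base r.fiber := by
    intro r
    have hI : ∀ a : ℂ, Complex.I * (Complex.I * a) = -a := fun a => by
      rw [← mul_assoc, Complex.I_mul_I, neg_one_mul]
    simp only [incl, ofComponents, base, fiber, Prod.mk.injEq]
    refine ⟨?_, ?_, ?_, ?_⟩ <;> simp [hI, Complex.conj_ofNat] <;> ring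
  exact isClosedEmbedding_incl.injective (by rw [h, h, hb, hf])

theorem ofTangent_normalize_fiber [Fact (0 < μ)] (s : Conifold μ) :
    ofTangent (normalize s.base) s.fiber s.inner_fiber_normalize = s := by
  refine ext_components ?_ (fiber_ofTangent _ _ _)
  rw [base_ofTangent, ← norm_base_sq, Real.sqrt_sq (norm_nonneg _), coe_normalize s.base_ne_zero,
    smul_smul, mul_inv_cancel₀ (norm_ne_zero_iff.2 s.base_ne_zero), one_smul]

theorem ofTangent_smul [Fact (0 < μ)] {p q : ℕ} [LensPair p q] (g : CyclicGp p q) (v : S3)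
    (w : C2) (h : inner ℝ w (v : C2) = 0) (h' : inner ℝ (rot g w) ((g • v : S3) : C2) = 0) :
    ofTangent (μ := μ) (g • v) (rot g w) h' = g • ofTangent v w h := by
  refine ext_components ?_ ?_
  · rw [base_smul, base_ofTangent, base_ofTangent, norm_rot, coe_smul, ← rotL_apply, ← rotL_apply,
      map_smul]
  · rw [fiber_smul, fiber_ofTangent, fiber_ofTangent]

theorem contMDiff_base [Fact (0 < μ)] :
    ContMDiff 𝓘(ℝ, ℂ × ℂ × ℂ) 𝓘(ℝ, C2) ∞ (base (μ := μ)) := by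
  have h : ContDiff ℝ ∞ (fun r : ℂ × ℂ × ℂ × ℂ =>
      (!₂[(r.1 + conj r.2.1) / 2, (r.2.2.1 - conj r.2.2.2) / 2] : C2)) := by
    have hc : ContDiff ℝ ∞ (fun a : ℂ => conj a) := Complex.conjCLE.contDiff
    rw [contDiff_piLp]
    intro i
    fin_cases i <;> simp <;> fun_prop
  exact h.contMDiff.comp contMDiff_incl

theorem contMDiff_fiber [Fact (0 < μ)] :
    ContMDiff 𝓘(ℝ, ℂ × ℂ × ℂ) 𝓘(ℝ, C2) ∞ (fiber (μ := μ)) := by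
  have h : ContDiff ℝ ∞ (fun r : ℂ × ℂ × ℂ × ℂ =>
      (!₂[-Complex.I * ((r.1 - conj r.2.1) / 2), -Complex.I * ((r.2.2.1 + conj r.2.2.2) / 2)] :
        C2)) := by
    have hc : ContDiff ℝ ∞ (fun a : ℂ => conj a) := Complex.conjCLE.contDiff
    rw [contDiff_piLp]
    intro i
    fin_cases i
    · exact (by fun_prop : ContDiff ℝ ∞ fun r : ℂ × ℂ × ℂ × ℂ =>
        -Complex.I * ((r.1 - conj r.2.1) / 2))
    · exact (by fun_prop : ContDiff ℝ ∞ fun r : ℂ × ℂ × ℂ × ℂ =>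
        -Complex.I * ((r.2.2.1 + conj r.2.2.2) / 2))
  refine (h.contMDiff.comp contMDiff_incl).congr fun s => ?_
  simp only [Function.comp_apply, incl, fiber]

/-- The square root is smooth because `μ + ‖w‖²` is positive. The formula makes sense on all of `ℂ²
× ℂ²`, so no smooth structure on the set of orthogonal pairs is needed. -/
theorem contDiff_ofComponents [hμ : Fact (0 < μ)] : ContDiff ℝ ∞
    (fun r : C2 × C2 => ofComponents (√(μ + ‖r.2‖ ^ 2) • r.1) r.2) := by
  have hc : ContDiff ℝ ∞ (fun a : ℂ => conj a) := Complex.conjCLE.contDiff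
  have hs : ContDiff ℝ ∞ (fun r : C2 × C2 => √(μ + ‖r.2‖ ^ 2)) :=
    (contDiff_const.add (contDiff_snd.norm_sq ℝ)).sqrt fun r => by have := hμ.out; positivity
  have h1 : ContDiff ℝ ∞ (fun r : C2 × C2 => √(μ + ‖r.2‖ ^ 2) • r.1) := hs.smul contDiff_fst
  have h2 : ContDiff ℝ ∞ (fun r : C2 × C2 => ofComponents r.1 r.2) := by
    unfold ofComponents
    fun_prop
  exact h2.comp (h1.prodMk contDiff_snd)

end Conifold

/-! ### The two mutually inverse maps between the orbit space and the cotangent bundle. -/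

namespace ConifoldQuotient

open Conifold

variable {p q : ℕ} [LensPair p q] {μ : ℝ} [Fact (0 < μ)]

/-- The map from the deformed conifold to the cotangent bundle of the lens space. -/
def liftCotangent (p q : ℕ) [LensPair p q] (s : Conifold μ) :
    CotangentBundle (𝓡 3) (LensSpace p q) :=
  cotangent p q (normalize s.base) s.fiber

theorem liftCotangent_smul (g : CyclicGp p q) (s : Conifold μ) :
    liftCotangent p q (g • s) = liftCotangent p q s := by
  rw [liftCotangent, base_smul, fiber_smul, normalize_smul g s.base_ne_zero, cotangent_smul,
    liftCotangent]

theorem contMDiff_liftCotangent : ContMDiff 𝓘(ℝ, ℂ × ℂ × ℂ)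
    ((𝓡 3).prod 𝓘(ℝ, EuclideanSpace ℝ (Fin 3) →L[ℝ] ℝ)) ∞
    (liftCotangent p q : Conifold μ → _) := fun s =>
  contMDiffAt_cotangent ((contMDiffAt_normalize s.base_ne_zero).comp s (contMDiff_base s))
    (contMDiff_fiber s)

/-- The map from the orbit space to the cotangent bundle of the lens space. -/
def toCotangent (p q : ℕ) [LensPair p q] (s : ConifoldQuotient p q μ) :
    CotangentBundle (𝓡 3) (LensSpace p q) :=
  Quotient.lift (liftCotangent p q) (by
    rintro s s' h
    obtain ⟨g, rfl⟩ := orbitMk_eq_iff.1 (Quotient.sound h : orbitMk (CyclicGp p q) s = _)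
    exact liftCotangent_smul g s') s

theorem toCotangent_orbitMk (s : Conifold μ) :
    toCotangent p q (orbitMk _ s) = liftCotangent p q s := rfl

theorem contMDiff_toCotangent : ContMDiff 𝓘(ℝ, ℂ × ℂ × ℂ)
    ((𝓡 3).prod 𝓘(ℝ, EuclideanSpace ℝ (Fin 3) →L[ℝ] ℝ)) ∞
    (toCotangent p q : ConifoldQuotient p q μ → _) :=
  contMDiff_of_comp_orbitMk Conifold.contMDiff_smul contMDiff_liftCotangent

/-- The point of the conifold over `v` represented by the covector `ξ`. -/
def ofCovector (p q : ℕ) [LensPair p q] (μ : ℝ) [Fact (0 < μ)] (v : S3)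
    (ξ : EuclideanSpace ℝ (Fin 3) →L[ℝ] ℝ) : Conifold μ :=
  ofTangent v (codual p q v ξ) (inner_codual_self v ξ)

theorem ofCovector_smul (g : CyclicGp p q) (v : S3) (ξ : EuclideanSpace ℝ (Fin 3) →L[ℝ] ℝ) :
    ofCovector p q μ (g • v) ξ = g • ofCovector p q μ v ξ := by
  simp only [ofCovector, codual_smul]
  exact ofTangent_smul g v _ _ _

/-- The inverse map, from the cotangent bundle of the lens space to the orbit space. -/
def ofCotangent (p q : ℕ) [LensPair p q] (μ : ℝ) [Fact (0 < μ)]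
    (ζ : CotangentBundle (𝓡 3) (LensSpace p q)) : ConifoldQuotient p q μ :=
  orbitMk _ (ofCovector p q μ ζ.proj.out ζ.2)

/-- Equivariance of `ofCovector` makes the chosen representative irrelevant. It may then be replaced
by a smooth local section, which gives smoothness of the inverse. -/
theorem ofCotangent_eq {v : S3} {ζ : CotangentBundle (𝓡 3) (LensSpace p q)}
    (h : orbitMk _ v = ζ.proj) : ofCotangent p q μ ζ = orbitMk _ (ofCovector p q μ v ζ.2) := by
  have h' : orbitMk (CyclicGp p q) ζ.proj.out = orbitMk (CyclicGp p q) v := by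
    rw [h]; exact Quotient.out_eq ζ.proj
  obtain ⟨g, hg⟩ := orbitMk_eq_iff.1 h'
  rw [ofCotangent, ← hg]
  exact (congrArg (orbitMk _) (ofCovector_smul g v ζ.2)).trans (orbitMk_smul g _)

theorem liftCotangent_ofCovector (v : S3) (ξ : EuclideanSpace ℝ (Fin 3) →L[ℝ] ℝ) :
    liftCotangent p q (ofCovector p q μ v ξ) = ⟨orbitMk _ v, ξ⟩ := by
  rw [liftCotangent, ofCovector, normalize_base_ofTangent, fiber_ofTangent, cotangent,
    covector_codual]

theorem ofCotangent_toCotangent (s : ConifoldQuotient p q μ) :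
    ofCotangent p q μ (toCotangent p q s) = s := by
  obtain ⟨s, rfl⟩ := orbitMk_surjective s
  rw [toCotangent_orbitMk, ofCotangent_eq (v := normalize s.base) rfl]
  congr 1
  have h : codual p q (normalize s.base) (liftCotangent p q s).2 = s.fiber :=
    codual_covector s.inner_fiber_normalize
  simp only [ofCovector, h]
  exact s.ofTangent_normalize_fiber

theorem toCotangent_ofCotangent (ζ : CotangentBundle (𝓡 3) (LensSpace p q)) :
    toCotangent p q (ofCotangent p q μ ζ) = ζ := by
  obtain ⟨m, ξ⟩ := ζ
  obtain ⟨v, rfl⟩ := orbitMk_surjective m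
  rw [ofCotangent_eq (v := v) rfl, toCotangent_orbitMk]
  exact liftCotangent_ofCovector v ξ

theorem contMDiff_ofCotangent : ContMDiff ((𝓡 3).prod 𝓘(ℝ, EuclideanSpace ℝ (Fin 3) →L[ℝ] ℝ))
    𝓘(ℝ, ℂ × ℂ × ℂ) ∞ (ofCotangent p q μ) := by
  intro ζ
  obtain ⟨v, hv⟩ := orbitMk_surjective (G := CyclicGp p q) ζ.proj
  have h1 : ContMDiffAt ((𝓡 3).prod 𝓘(ℝ, EuclideanSpace ℝ (Fin 3) →L[ℝ] ℝ)) 𝓘(ℝ, C2) ∞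
      (fun η : CotangentBundle (𝓡 3) (LensSpace p q) => lift p q v η.proj) ζ :=
    ContMDiffAt.comp (g := lift p q v) ζ (by rw [← hv]; exact contMDiffAt_lift v)
      (Bundle.contMDiffAt_proj _)
  have h2 : ContMDiffAt ((𝓡 3).prod 𝓘(ℝ, EuclideanSpace ℝ (Fin 3) →L[ℝ] ℝ))
      𝓘(ℝ, ℂ × ℂ × ℂ) ∞ (fun η : CotangentBundle (𝓡 3) (LensSpace p q) =>
        ofCovector p q μ (orbitSection _ v η.proj) η.2) ζ :=
    -- In `ℂ⁴` the map is the explicit formula of `contDiff_ofComponents` applied to the local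
    -- section and the representing vector.
    contMDiffAt_of_incl (ContMDiffAt.comp (f := fun η : CotangentBundle (𝓡 3) (LensSpace p q) =>
        (lift p q v η.proj, codual p q (orbitSection _ v η.proj) η.2)) ζ (contDiff_ofComponents (μ := μ)).contMDiff.contMDiffAt
      (h1.prodMk_space (contMDiffAt_codual ζ hv.symm)))
  refine (((contMDiff_orbitMk (G := CyclicGp p q) Conifold.contMDiff_smul) _).comp ζ
    h2).congr_of_eventuallyEq ?_
  have hc : ContinuousAt (fun η : CotangentBundle (𝓡 3) (LensSpace p q) => η.proj) ζ :=
    (FiberBundle.continuous_proj _ _).continuousAt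
  have he := eventually_orbitMk_orbitSection (G := CyclicGp p q) v
  rw [hv] at he
  filter_upwards [hc.eventually he] with η hη
  exact ofCotangent_eq hη

end ConifoldQuotient

end

theorem mainTheorem6 (p q : ℕ) [LensPair p q] (μ : ℝ) [Fact (0 < μ)] :
    Nonempty (Diffeomorph 𝓘(ℝ, ℂ × ℂ × ℂ) ((𝓡 3).prod 𝓘(ℝ, EuclideanSpace ℝ (Fin 3) →L[ℝ] ℝ))
      (ConifoldQuotient p q μ) (CotangentBundle (𝓡 3) (LensSpace p q)) ∞) :=
  ⟨{ toFun := ConifoldQuotient.toCotangent p q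
     invFun := ConifoldQuotient.ofCotangent p q μ
     left_inv := ConifoldQuotient.ofCotangent_toCotangent
     right_inv := ConifoldQuotient.toCotangent_ofCotangent
     contMDiff_toFun := ConifoldQuotient.contMDiff_toCotangent
     contMDiff_invFun := ConifoldQuotient.contMDiff_ofCotangent }⟩
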